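/- Let $I$ be a set and let $1\le p\le\infty$ with $p\neq 2$. For $p<\infty$ let $S_p^I$ be the space of compact operators $A$ on the complex Hilbert space $\ell_2^I$ with $\|A\|_{S_p^I}=\big(\mathrm{Tr}\,(A^*A)^{p/2}\big)^{1/p}<\infty$, and let $S_\infty^I$ be the space of all compact operators on $\ell_2^I$ with the operator norm; operators on $\ell_2^I$ are identified with their matrices in the canonical basis. A complex matrix $C=[c_{ij}]_{i,j\in I}$ defines a Schur multiplier $M_C$ on $S_p^I$ if for every $A=[a_{ij}]\in S_p^I$ the matrix $[c_{ij}a_{ij}]$ represents an element $M_C(A)$ of $S_p^I$; it is called isometric if moreover $\|M_C(A)\|_{S_p^I}=\|A\|_{S_p^I}$ for all $A\in S_p^I$. A complex matrix $C=[c_{ij}]_{i,j\in I}$ defines an isometric Schur multiplier on $S_p^I$ if and only if there exist families $(a_i)_{i\in I}$ and $(b_j)_{j\in I}$ of complex numbers of modulus one such that $c_{ij}=a_ib_j$ for all $i,j\in I$. -/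

import Mathlib

open scoped ENNReal Matrix InnerProductSpace

noncomputable section

namespace SchurMult

/-- The complex Hilbert space `ℓ²(I)` of square summable families indexed by `I`. -/
def Ell2 (I : Type*) : Type _ := lp (fun _ : I => ℂ) 2

instance (I : Type*) : NormedAddCommGroup (Ell2 I) :=
  inferInstanceAs (NormedAddCommGroup (lp (fun _ : I => ℂ) 2))

instance (I : Type*) : InnerProductSpace ℂ (Ell2 I) :=
  inferInstanceAs (InnerProductSpace ℂ (lp (fun _ : I => ℂ) 2))

instance (I : Type*) : CompleteSpace (Ell2 I) :=
  inferInstanceAs (CompleteSpace (lp (fun _ : I => ℂ) 2))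

/-- The canonical orthonormal basis `e` of `ℓ²(I)`. -/
def canonicalBasis (I : Type*) : HilbertBasis I ℂ (Ell2 I) :=
  HilbertBasis.ofRepr (LinearIsometryEquiv.refl ℂ (lp (fun _ : I => ℂ) 2))

/-- The canonical basis vector `e i` of `ℓ²(I)`. -/
def basisVec {I : Type*} (i : I) : Ell2 I := canonicalBasis I i

/-- The matrix `[a i j]` of a bounded operator `A` on `ℓ²(I)`, with `a i j = ⟪e i, A (e j)⟫`,
the `i`-th coordinate of `A (e j)`. -/
def opMatrix {I : Type*} (A : Ell2 I →L[ℂ] Ell2 I) : Matrix I I ℂ :=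
  Matrix.of fun i j => ⟪basisVec i, A (basisVec j)⟫_ℂ

/-- The trace `∑ i, ⟪e i, T (e i)⟫`, in `[0, ∞]`, of a positive operator `T` on `ℓ²(I)`. -/
def posTrace {I : Type*} (T : Ell2 I →L[ℂ] Ell2 I) : ℝ≥0∞ :=
  ∑' i, ENNReal.ofReal (RCLike.re ⟪basisVec i, T (basisVec i)⟫_ℂ)

/-- The operator `(A* A) ^ (r / 2)` on a Hilbert space, through the continuous functional
calculus for the positive operator `A* A`. -/
def modulusPow {H : Type*} [NormedAddCommGroup H] [InnerProductSpace ℂ H] [CompleteSpace H]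
    (A : H →L[ℂ] H) (r : ℝ) : H →L[ℂ] H :=
  (star A * A) ^ (r / 2)

/-- The Schatten norm with values in `[0, ∞]`: it is `(Tr ((A* A) ^ (p / 2))) ^ (1 / p)` for
finite `p`, and the operator norm for `p = ∞`. -/
def schattenNorm {I : Type*} (p : ℝ≥0∞) (A : Ell2 I →L[ℂ] Ell2 I) : ℝ≥0∞ :=
  if p = ∞ then ‖A‖ₑ
  else posTrace (modulusPow A p.toReal) ^ (1 / p.toReal)

/-- The Schatten class `S_p^I`: the compact operators on `ℓ²(I)` of finite Schatten norm. For
`p = ∞` these are all compact operators. -/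
def schattenClass (I : Type*) (p : ℝ≥0∞) : Set (Ell2 I →L[ℂ] Ell2 I) :=
  {A | IsCompactOperator A ∧ schattenNorm p A < ∞}

/-- An operator is determined by its matrix. -/
theorem opMatrix_injective {I : Type*} :
    Function.Injective (opMatrix : (Ell2 I →L[ℂ] Ell2 I) → Matrix I I ℂ) := by
  intro A B h
  have hb : ∀ j, A (basisVec j) = B (basisVec j) := fun j => by
    apply (canonicalBasis I).repr.injective
    ext i
    rw [HilbertBasis.repr_apply_apply, HilbertBasis.repr_apply_apply]
    exact congrFun (congrFun h i) j
  refine ContinuousLinearMap.ext_on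
    (Submodule.dense_iff_topologicalClosure_eq_top.mpr (canonicalBasis I).dense_span) ?_
  rintro _ ⟨j, rfl⟩
  exact hb j

/-- `C` defines a Schur multiplier `M_C` on `S_p^I`: for every `A ∈ S_p^I` the Schur product of
`C` with the matrix of `A` is the matrix of an element `M_C A` of `S_p^I` (a unique one, by
`opMatrix_injective`). -/
def IsSchurMultiplier {I : Type*} (p : ℝ≥0∞) (C : Matrix I I ℂ) : Prop :=
  ∀ A ∈ schattenClass I p, ∃ B ∈ schattenClass I p, opMatrix B = C ⊙ opMatrix A

/-- The map `M_C : S_p^I → S_p^I`, sending `A` to the operator whose matrix is the Schur product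
of `C` with the matrix of `A`. -/
def IsSchurMultiplier.map {I : Type*} {p : ℝ≥0∞} {C : Matrix I I ℂ}
    (h : IsSchurMultiplier p C) (A : schattenClass I p) : schattenClass I p :=
  ⟨(h A.1 A.2).choose, (h A.1 A.2).choose_spec.1⟩

theorem IsSchurMultiplier.opMatrix_map {I : Type*} {p : ℝ≥0∞} {C : Matrix I I ℂ}
    (h : IsSchurMultiplier p C) (A : schattenClass I p) :
    opMatrix (h.map A).1 = C ⊙ opMatrix A.1 :=
  (h A.1 A.2).choose_spec.2

/-- `C` defines an isometric Schur multiplier on `S_p^I`: the linear map `M_C` is defined on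
`S_p^I` and preserves the Schatten norm. -/
def IsIsometricSchurMultiplier {I : Type*} (p : ℝ≥0∞) (C : Matrix I I ℂ) : Prop :=
  ∃ h : IsSchurMultiplier p C,
    ∀ A : schattenClass I p, schattenNorm p (h.map A).1 = schattenNorm p A.1

end SchurMult

end

open scoped ENNReal Matrix InnerProductSpace

noncomputable section

namespace SchurMult

open InnerProductSpace

variable {I : Type*}

/-! If `c_ij = a_i b_j`, then `M_C A = U A V` with `U`, `V` diagonal unitaries, and Schatten norms
are unitarily invariant (`schattenNorm_rotate`).

Conversely, matrix units give `|c_ij| = 1`. The all-ones block on rows `i, k` and columns `j, l` has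
rank one and norm 2 for every `p`; its image `B` has two columns `u`, `v` with `‖u‖² = ‖v‖² = 2`.
Then `T = B* B` has trace 4 and spectrum in `[0, 4]`, and for finite `p` isometry gives `Tr T^(p/2)
= 4^(p/2)`. Since `p/2 ≠ 1`, strict comparison of `x^(p/2)` with its chord on `[0, 4]` forces the
nonzero spectrum to be `{4}`; for `p = ∞`, `‖T‖ = 4` is immediate. Hence `|⟪u, v⟫| = 2`, the
equality case of the triangle inequality, so every 2×2 minor of `C` vanishes (`mul_eq_mul`) and `C`
factors. -/

theorem orthonormal_basisVec : Orthonormal ℂ (basisVec : I → Ell2 I) :=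
  (canonicalBasis I).orthonormal

theorem inner_basisVec [DecidableEq I] (i j : I) :
    ⟪basisVec i, basisVec j⟫_ℂ = if i = j then 1 else 0 :=
  orthonormal_iff_ite.mp orthonormal_basisVec i j

theorem norm_basisVec (i : I) : ‖(basisVec i : Ell2 I)‖ = 1 :=
  orthonormal_basisVec.1 i

theorem ext_basisVec {A B : Ell2 I →L[ℂ] Ell2 I} (h : ∀ j, A (basisVec j) = B (basisVec j)) :
    A = B :=
  opMatrix_injective <| by ext i j; simp [opMatrix, h]

theorem isCompactOperator_rankOne (x y : Ell2 I) : IsCompactOperator (rankOne ℂ x y) := by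
  have h : IsCompactOperator (ContinuousLinearMap.toSpanSingleton ℂ x) :=
    isCompactOperator_of_locallyCompactSpace_rng _
  exact h.comp_clm (innerSL ℂ y)

/-! ### The modulus power and the trace -/

theorem modulusPow_eq_cfc (A : Ell2 I →L[ℂ] Ell2 I) (r : ℝ) :
    modulusPow A r = cfc (fun x : ℝ => x ^ (r / 2)) (star A * A) :=
  CFC.rpow_eq_cfc_real (star_mul_self_nonneg A)

/-- The relation `T² = kT` confines the spectrum to `{0, k}`, where `x ^ q` and `k ^ (q - 1) * x`
agree. -/
theorem cfc_rpow_of_mul_self {T : Ell2 I →L[ℂ] Ell2 I} (hT : IsSelfAdjoint T) {k q : ℝ}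
    (hk : 0 < k) (hq : 0 < q) (h : T * T = k • T) :
    cfc (fun x : ℝ => x ^ q) T = k ^ (q - 1) • T := by
  have hs : (spectrum ℝ T).EqOn (fun x : ℝ => x ^ 2) (fun x => k * x) := by
    apply eqOn_of_cfc_eq_cfc (p := IsSelfAdjoint)
    rw [cfc_pow_id .., cfc_const_mul_id .., pow_two, h]
  rw [← cfc_const_mul_id (k ^ (q - 1)) T]
  apply cfc_congr
  intro x hx
  have h1 : x * (x - k) = 0 := by
    have := hs hx
    simp only at this
    linear_combination this
  rcases mul_eq_zero.mp h1 with rfl | h1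
  · simp [hq.ne']
  · obtain rfl : x = k := by linarith
    simp only
    rw [Real.rpow_sub_one hk.ne']
    field_simp

theorem posTrace_smul {c : ℝ} (hc : 0 ≤ c) (T : Ell2 I →L[ℂ] Ell2 I) :
    posTrace (c • T) = ENNReal.ofReal c * posTrace T := by
  rw [posTrace, posTrace, ← ENNReal.tsum_mul_left]
  congr 1
  ext i
  rw [← ENNReal.ofReal_mul hc]
  simp [inner_smul_right_eq_smul]

theorem posTrace_star_mul_self (A : Ell2 I →L[ℂ] Ell2 I) :
    posTrace (star A * A) = ∑' i, ENNReal.ofReal (‖A (basisVec i)‖ ^ 2) := by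
  rw [posTrace]
  congr 1
  ext i
  rw [mul_apply_eq_comp, ContinuousLinearMap.star_eq_adjoint,
    ContinuousLinearMap.adjoint_inner_right, inner_self_eq_norm_sq]

theorem posTrace_rankOne_self (y : Ell2 I) :
    posTrace (rankOne ℂ y y) = ENNReal.ofReal (‖y‖ ^ 2) := by
  have h := (canonicalBasis I).hasSum_inner_mul_inner y y
  have h2 := (RCLike.hasSum_re ℂ h)
  rw [inner_self_eq_norm_sq] at h2
  rw [← h2.tsum_eq, ENNReal.ofReal_tsum_of_nonneg _ h2.summable]
  · rw [posTrace]
    congr 1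
    ext i
    rw [rankOne_apply, inner_smul_right]
    rfl
  · intro i
    rw [← inner_conj_symm, ← Complex.normSq_eq_conj_mul_self]
    simp [Complex.normSq_nonneg]

theorem star_rankOne_mul_self (x y : Ell2 I) :
    star (rankOne ℂ x y) * rankOne ℂ x y = (‖x‖ ^ 2) • rankOne ℂ y y := by
  rw [ContinuousLinearMap.star_eq_adjoint, adjoint_rankOne, ContinuousLinearMap.mul_def,
    rankOne_comp_rankOne, inner_self_eq_norm_sq_to_K, ← RCLike.ofReal_pow,
    ← RCLike.real_smul_eq_coe_smul]

theorem schattenNorm_rankOne {p : ℝ≥0∞} (hp : 1 ≤ p) (x y : Ell2 I) :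
    schattenNorm p (rankOne ℂ x y) = ENNReal.ofReal (‖x‖ * ‖y‖) := by
  rw [schattenNorm]
  split_ifs with hpt
  · rw [← norm_rankOne (𝕜 := ℂ), ofReal_norm]
  have hp0 : 0 < p.toReal := ENNReal.toReal_pos (by positivity) hpt
  have hsq := star_rankOne_mul_self x y
  rw [modulusPow_eq_cfc]
  by_cases h0 : ‖x‖ * ‖y‖ = 0
  · have : rankOne ℂ x y = 0 := by
      rw [← norm_eq_zero, norm_rankOne, h0]
    have h2 : cfc (fun x : ℝ => x ^ (p.toReal / 2)) (0 : Ell2 I →L[ℂ] Ell2 I) = 0 := by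
      rw [cfc_apply_zero, Real.zero_rpow (by positivity)]; simp
    rw [this, h0, mul_zero, h2]
    simp [posTrace, hp0]
  · have hx : 0 < ‖x‖ := (norm_nonneg x).lt_of_ne' (left_ne_zero_of_mul h0)
    have hy : 0 < ‖y‖ := (norm_nonneg y).lt_of_ne' (right_ne_zero_of_mul h0)
    -- This `k` is the only nonzero eigenvalue of `‖x‖² • rankOne ℂ y y`.
    rw [cfc_rpow_of_mul_self (k := ‖x‖ ^ 2 * ‖y‖ ^ 2) (.star_mul_self _) (by positivity)
      (by positivity), hsq, smul_smul, posTrace_smul (by positivity), posTrace_rankOne_self,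
      ← ENNReal.ofReal_mul (by positivity), ENNReal.ofReal_rpow_of_nonneg (by positivity) (by positivity)]
    · congr 1
      rw [mul_assoc, Real.rpow_sub_one (by positivity), div_mul_cancel₀ _ (by positivity), ← mul_pow,
        ← Real.rpow_natCast, ← Real.rpow_mul (by positivity), ← Real.rpow_mul (by positivity)]
      push_cast
      rw [show (2 * (p.toReal / 2 * (1 / p.toReal))) = 1 by field_simp, Real.rpow_one]
    · rw [hsq, smul_mul_smul_comm, ContinuousLinearMap.mul_def, rankOne_comp_rankOne,
        inner_self_eq_norm_sq_to_K, ← RCLike.ofReal_pow, ← RCLike.real_smul_eq_coe_smul, smul_smul,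
        smul_smul]
      congr 1
      ring

theorem rankOne_mem_schattenClass {p : ℝ≥0∞} (hp : 1 ≤ p) (x y : Ell2 I) :
    rankOne ℂ x y ∈ schattenClass I p :=
  ⟨isCompactOperator_rankOne x y, by rw [schattenNorm_rankOne hp]; exact ENNReal.ofReal_lt_top⟩

/-- Faithfulness of the trace: equal finite traces force `R - S = Q* Q` to have zero diagonal, and
its diagonal entries are `‖Q e_i‖²`. -/
theorem eq_of_le_of_posTrace_eq {S R : Ell2 I →L[ℂ] Ell2 I} (hS : 0 ≤ S) (h : S ≤ R)
    (ht : posTrace S = posTrace R) (hfin : posTrace R ≠ ∞) : S = R := by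
  have hD : 0 ≤ R - S := sub_nonneg.mpr h
  have hre : ∀ i : I, RCLike.re ⟪basisVec i, S (basisVec i)⟫_ℂ ≤
      RCLike.re ⟪basisVec i, R (basisVec i)⟫_ℂ := fun i => by
    have := ((ContinuousLinearMap.nonneg_iff_isPositive _).mp hD).re_inner_nonneg_right (basisVec i)
    simpa [inner_sub_right] using this
  have hdiag : ∀ i : I, RCLike.re ⟪basisVec i, (R - S) (basisVec i)⟫_ℂ = 0 := fun i => by
    by_contra hne
    refine absurd ht (ne_of_lt (ENNReal.tsum_lt_tsum (i := i) (ne_of_eq_of_ne ht hfin)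
      (fun j => ENNReal.ofReal_le_ofReal (hre j)) ?_))
    have hlt := lt_of_le_of_ne (hre i) (fun he => hne (by
      rw [sub_apply, inner_sub_right, map_sub, he, sub_self]))
    exact (ENNReal.ofReal_lt_ofReal_iff_of_nonneg
      (((ContinuousLinearMap.nonneg_iff_isPositive _).mp hS).re_inner_nonneg_right _)).mpr hlt
  obtain ⟨Q, hQ⟩ := CStarAlgebra.nonneg_iff_eq_star_mul_self.mp hD
  have hQ0 : ∀ i : I, Q (basisVec i) = 0 := fun i => by
    have := hdiag i
    rw [hQ, mul_apply_eq_comp, ContinuousLinearMap.star_eq_adjoint,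
      ContinuousLinearMap.adjoint_inner_right, inner_self_eq_norm_sq] at this
    simpa using this
  refine (sub_eq_zero.mp ?_).symm
  refine ext_basisVec fun j => ?_
  rw [hQ, mul_apply_eq_comp, hQ0]; simp

section TwoColumns

/-! ### Operators with two nonzero columns -/

/-- The operator whose `j`-th column is `u`, whose `l`-th column is `v`, and whose other columns
vanish. -/
def twoColumns (j l : I) (u v : Ell2 I) : Ell2 I →L[ℂ] Ell2 I :=
  rankOne ℂ u (basisVec j) + rankOne ℂ v (basisVec l)

variable {j l : I} {u v : Ell2 I}

theorem twoColumns_apply_left (hjl : j ≠ l) : twoColumns j l u v (basisVec j) = u := by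
  classical
  simp [twoColumns, inner_basisVec, norm_basisVec, hjl.symm]

theorem twoColumns_apply_right (hjl : j ≠ l) : twoColumns j l u v (basisVec l) = v := by
  classical
  simp [twoColumns, inner_basisVec, norm_basisVec, hjl]

theorem twoColumns_apply_of_ne {m : I} (hj : m ≠ j) (hl : m ≠ l) :
    twoColumns j l u v (basisVec m) = 0 := by
  classical
  simp [twoColumns, inner_basisVec, hj.symm, hl.symm]

theorem star_twoColumns_apply (x : Ell2 I) :
    star (twoColumns j l u v) x = ⟪u, x⟫_ℂ • basisVec j + ⟪v, x⟫_ℂ • basisVec l := by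
  simp [twoColumns, ContinuousLinearMap.star_eq_adjoint]

theorem gram_twoColumns_apply_left (hjl : j ≠ l) (hu : ‖u‖ ^ 2 = 2) :
    (star (twoColumns j l u v) * twoColumns j l u v) (basisVec j) =
      (2 : ℂ) • basisVec j + ⟪v, u⟫_ℂ • basisVec l := by
  rw [mul_apply_eq_comp, twoColumns_apply_left hjl, star_twoColumns_apply,
    inner_self_eq_norm_sq_to_K, ← RCLike.ofReal_pow, hu]
  simp

theorem gram_twoColumns_apply_right (hjl : j ≠ l) (hv : ‖v‖ ^ 2 = 2) :
    (star (twoColumns j l u v) * twoColumns j l u v) (basisVec l) =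
      ⟪u, v⟫_ℂ • basisVec j + (2 : ℂ) • basisVec l := by
  rw [mul_apply_eq_comp, twoColumns_apply_right hjl, star_twoColumns_apply,
    inner_self_eq_norm_sq_to_K, ← RCLike.ofReal_pow, hv]
  simp

/-- On the span of `e_j`, `e_l` this is Cayley–Hamilton for the Gram matrix of `u`, `v`, with trace
4 and determinant `4 - |⟪u, v⟫|²`. The extra factor `T` handles the other basis vectors, which `T`
kills. -/
theorem gram_twoColumns_cubic (hjl : j ≠ l) (hu : ‖u‖ ^ 2 = 2) (hv : ‖v‖ ^ 2 = 2) :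
    let T := star (twoColumns j l u v) * twoColumns j l u v
    T ^ 3 - (4 : ℝ) • T ^ 2 + (4 - ‖⟪u, v⟫_ℂ‖ ^ 2) • T = 0 := by
  intro T
  have hj : T (basisVec j) = _ := gram_twoColumns_apply_left hjl hu
  have hl : T (basisVec l) = _ := gram_twoColumns_apply_right hjl hv
  have hg : ⟪u, v⟫_ℂ * ⟪v, u⟫_ℂ = ((‖⟪u, v⟫_ℂ‖ ^ 2 : ℝ) : ℂ) := by
    rw [← inner_conj_symm v u, Complex.mul_conj, Complex.normSq_eq_norm_sq]
  refine ext_basisVec fun m => ?_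
  simp only [pow_succ, pow_zero, one_mul, add_apply,
    sub_apply, smul_apply, mul_apply_eq_comp,
    zero_apply, ← Complex.coe_smul]
  rcases eq_or_ne m j with rfl | hmj
  · simp only [hj, hl, map_add, map_smul, smul_add, smul_smul]
    push_cast [pow_two] at hg ⊢
    rw [← hg]
    module
  rcases eq_or_ne m l with rfl | hml
  · simp only [hj, hl, map_add, map_smul, smul_add, smul_smul]
    push_cast [pow_two] at hg ⊢
    rw [← hg]
    module
  · have : T (basisVec m) = 0 := by
      rw [mul_apply_eq_comp, twoColumns_apply_of_ne hmj hml, map_zero]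
    simp [this]

theorem spectrum_gram_twoColumns (hjl : j ≠ l) (hu : ‖u‖ ^ 2 = 2) (hv : ‖v‖ ^ 2 = 2) {t : ℝ}
    (ht : t ∈ spectrum ℝ (star (twoColumns j l u v) * twoColumns j l u v)) (h0 : t ≠ 0) :
    t * (4 - t) = 4 - ‖⟪u, v⟫_ℂ‖ ^ 2 := by
  have hc := gram_twoColumns_cubic hjl hu hv
  generalize 4 - ‖⟪u, v⟫_ℂ‖ ^ 2 = d at hc ⊢
  generalize star (twoColumns j l u v) * twoColumns j l u v = T at hc ht
  have : Nontrivial (Ell2 I) := ⟨basisVec j, 0, orthonormal_basisVec.ne_zero j⟩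
  open Polynomial in
  have h := spectrum.subset_polynomial_aeval T (X ^ 3 - C 4 * X ^ 2 + C d * X) ⟨t, ht, rfl⟩
  simp only [map_add, map_sub, map_mul, map_pow, Polynomial.aeval_X, Polynomial.aeval_C,
    ← Algebra.smul_def, hc, spectrum.zero_eq, Set.mem_singleton_iff, Polynomial.eval_add,
    Polynomial.eval_sub, Polynomial.eval_mul, Polynomial.eval_C, Polynomial.eval_pow,
    Polynomial.eval_X] at h
  apply mul_left_cancel₀ h0
  linear_combination -h

theorem posTrace_gram_twoColumns (hjl : j ≠ l) (hu : ‖u‖ ^ 2 = 2) (hv : ‖v‖ ^ 2 = 2) :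
    posTrace (star (twoColumns j l u v) * twoColumns j l u v) = ENNReal.ofReal 4 := by
  classical
  rw [posTrace_star_mul_self, tsum_eq_sum (s := {j, l})]
  · rw [Finset.sum_pair hjl, twoColumns_apply_left hjl, twoColumns_apply_right hjl, hu, hv,
      ← ENNReal.ofReal_add (by norm_num) (by norm_num)]
    norm_num
  · intro m hm
    simp only [Finset.mem_insert, Finset.mem_singleton, not_or] at hm
    simp [twoColumns_apply_of_ne hm.1 hm.2]

/-- The right side is the chord of `t ^ q` from 0 to 4. -/
theorem rpow_lt_of_lt_four {t q : ℝ} (h0 : 0 < t) (h4 : t < 4) (hq : 1 < q) :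
    t ^ q < 4 ^ (q - 1) * t := by
  have := Real.rpow_lt_rpow h0.le h4 (sub_pos.mpr hq)
  calc t ^ q = t ^ (q - 1) * t := by rw [Real.rpow_sub_one h0.ne', div_mul_cancel₀ _ h0.ne']
    _ < _ := by gcongr

theorem lt_rpow_of_lt_four {t q : ℝ} (h0 : 0 < t) (h4 : t < 4) (hq : q < 1) :
    4 ^ (q - 1) * t < t ^ q := by
  have := Real.rpow_lt_rpow_of_neg h0 h4 (sub_neg.mpr hq)
  calc _ < t ^ (q - 1) * t := by gcongr
    _ = _ := by rw [Real.rpow_sub_one h0.ne', div_mul_cancel₀ _ h0.ne']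

/-- A positive operator with spectrum in `[0, 4]` and trace `4`, whose `q`-th power has trace
`4 ^ q` for some `q ≠ 1`, has spectrum in `{0, 4}`. -/
theorem eq_four_of_posTrace_rpow {T : Ell2 I →L[ℂ] Ell2 I} (hT : 0 ≤ T) {q : ℝ} (hq : 0 < q)
    (hq1 : q ≠ 1) (hs : ∀ t ∈ spectrum ℝ T, t ≤ 4) (htr : posTrace T = ENNReal.ofReal 4)
    (htrq : posTrace (cfc (fun x : ℝ => x ^ q) T) = ENNReal.ofReal (4 ^ q)) {t : ℝ}
    (ht : t ∈ spectrum ℝ T) (h0 : t ≠ 0) : t = 4 := by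
  have hsa : IsSelfAdjoint T := .of_nonneg hT
  have hpos : ∀ t ∈ spectrum ℝ T, 0 ≤ t := fun t ht => spectrum_nonneg_of_nonneg hT ht
  have hc : ContinuousOn (fun x : ℝ => x ^ q) (spectrum ℝ T) :=
    (Real.continuous_rpow_const hq.le).continuousOn
  have hlin : cfc (fun x : ℝ => 4 ^ (q - 1) * x) T = (4 ^ (q - 1) : ℝ) • T :=
    cfc_const_mul_id _ _
  have htl : posTrace ((4 ^ (q - 1) : ℝ) • T) = ENNReal.ofReal (4 ^ q) := by
    rw [posTrace_smul (by positivity), htr, ← ENNReal.ofReal_mul (by positivity),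
      Real.rpow_sub_one (by norm_num), div_mul_cancel₀ _ (by norm_num)]
  have hcl : ContinuousOn (fun x : ℝ => 4 ^ (q - 1) * x) (spectrum ℝ T) := by fun_prop
  have hend : ∀ x ∈ spectrum ℝ T, x ^ q = 4 ^ (q - 1) * x ∨ 0 < x ∧ x < 4 := fun x hx => by
    rcases (hpos x hx).eq_or_lt with rfl | hx0
    · simp [hq.ne']
    rcases (hs x hx).eq_or_lt with rfl | hx4
    · exact .inl (by rw [Real.rpow_sub_one (by norm_num), div_mul_cancel₀ _ (by norm_num)])
    · exact .inr ⟨hx0, hx4⟩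
  -- The power and its chord give comparable positive operators, ordered according to the sign of `q
  -- - 1`, with the same finite trace.
  have heq : cfc (fun x : ℝ => x ^ q) T = cfc (fun x : ℝ => 4 ^ (q - 1) * x) T := by
    rcases hq1.lt_or_gt with h1 | h1
    · have hle : cfc (fun x : ℝ => 4 ^ (q - 1) * x) T ≤ cfc (fun x : ℝ => x ^ q) T :=
        cfc_mono (fun x hx => (hend x hx).elim (fun h => h.ge)
          (fun h => (lt_rpow_of_lt_four h.1 h.2 h1).le)) hcl hc
      have h0 : 0 ≤ cfc (fun x : ℝ => 4 ^ (q - 1) * x) T :=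
        cfc_nonneg fun x hx => mul_nonneg (by positivity) (hpos x hx)
      exact (eq_of_le_of_posTrace_eq h0 hle (by rw [hlin, htl, htrq])
        (by rw [htrq]; exact ENNReal.ofReal_ne_top)).symm
    · have hle : cfc (fun x : ℝ => x ^ q) T ≤ cfc (fun x : ℝ => 4 ^ (q - 1) * x) T :=
        cfc_mono (fun x hx => (hend x hx).elim (fun h => h.le)
          (fun h => (rpow_lt_of_lt_four h.1 h.2 h1).le)) hc hcl
      have h0 : 0 ≤ cfc (fun x : ℝ => x ^ q) T :=
        cfc_nonneg fun x hx => Real.rpow_nonneg (hpos x hx) _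
      exact eq_of_le_of_posTrace_eq h0 hle (by rw [hlin, htl, htrq])
        (by rw [hlin, htl]; exact ENNReal.ofReal_ne_top)
  have hpt : t ^ q = 4 ^ (q - 1) * t := eqOn_of_cfc_eq_cfc (p := IsSelfAdjoint) heq hc hcl hsa ht
  have ht0 : 0 < t := lt_of_le_of_ne (hpos t ht) h0.symm
  by_contra h4
  have ht4 : t < 4 := lt_of_le_of_ne (hs t ht) h4
  rcases hq1.lt_or_gt with h1 | h1
  · exact (lt_rpow_of_lt_four ht0 ht4 h1).ne' hpt
  · exact (rpow_lt_of_lt_four ht0 ht4 h1).ne hpt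

theorem norm_inner_of_schattenNorm_twoColumns {p : ℝ≥0∞} (hp : 1 ≤ p) (hp2 : p ≠ 2) (hjl : j ≠ l)
    (hu : ‖u‖ ^ 2 = 2) (hv : ‖v‖ ^ 2 = 2)
    (h : schattenNorm p (twoColumns j l u v) = ENNReal.ofReal 2) : ‖⟪u, v⟫_ℂ‖ = 2 := by
  set B := twoColumns j l u v with hB
  set T := star B * B with hTdef
  have hT : 0 ≤ T := star_mul_self_nonneg B
  have : Nontrivial (Ell2 I) := ⟨basisVec j, 0, orthonormal_basisVec.ne_zero j⟩
  -- One nonzero spectral point suffices: once it equals 4, the quadratic relation gives `4 - |⟪u,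
  -- v⟫|² = 0`.
  have hmem : ‖T‖ ∈ spectrum ℝ T := CStarAlgebra.norm_mem_spectrum_of_nonneg hT
  have hBne : B ≠ 0 := by
    intro h0
    have h1 : u = 0 := by rw [← twoColumns_apply_left (u := u) (v := v) hjl, ← hB, h0]; rfl
    rw [h1] at hu
    norm_num at hu
  have hTne : ‖T‖ ≠ 0 := by
    rw [CStarRing.norm_star_mul_self]
    exact mul_ne_zero (norm_ne_zero_iff.mpr hBne) (norm_ne_zero_iff.mpr hBne)
  have hspec : ∀ t ∈ spectrum ℝ T, t ≠ 0 → t * (4 - t) = 4 - ‖⟪u, v⟫_ℂ‖ ^ 2 :=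
    fun t ht => spectrum_gram_twoColumns hjl hu hv ht
  have hle : ‖⟪u, v⟫_ℂ‖ ^ 2 ≤ 4 := by
    have := pow_le_pow_left₀ (norm_nonneg _) (norm_inner_le_norm (𝕜 := ℂ) u v) 2
    rw [mul_pow, hu, hv] at this
    linarith
  have key : ‖T‖ = 4 := by
    rw [schattenNorm] at h
    split_ifs at h with hpt
    · rw [← ofReal_norm, ENNReal.ofReal_eq_ofReal_iff (norm_nonneg _) (by norm_num)] at h
      rw [CStarRing.norm_star_mul_self, h]
      norm_num
    · have hp0 : 0 < p.toReal := ENNReal.toReal_pos (by positivity) hpt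
      refine eq_four_of_posTrace_rpow hT (q := p.toReal / 2) (by positivity) ?_ ?_
        (posTrace_gram_twoColumns hjl hu hv) ?_ hmem hTne
      · intro h1
        apply hp2
        rw [← ENNReal.ofReal_toReal hpt, show p.toReal = 2 by linarith]
        simp
      -- For `t > 4` the product `t * (4 - t)` would be negative, against Cauchy–Schwarz.
      · intro t ht
        by_contra hlt
        push Not at hlt
        have := hspec t ht (by linarith)
        nlinarith
      · rw [← modulusPow_eq_cfc]
        have h2 := congrArg (· ^ p.toReal) h
        simp only [← ENNReal.rpow_mul] at h2
        rw [one_div_mul_cancel hp0.ne', ENNReal.rpow_one,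
          ENNReal.ofReal_rpow_of_nonneg (by norm_num) hp0.le] at h2
        rw [h2, show (4 : ℝ) = 2 ^ (2 : ℝ) by norm_num, ← Real.rpow_mul (by norm_num)]
        congr 2
        ring
  have := hspec _ hmem hTne
  rw [key] at this
  nlinarith [norm_nonneg ⟪u, v⟫_ℂ]

end TwoColumns

theorem opMatrix_apply (A : Ell2 I →L[ℂ] Ell2 I) (i j : I) :
    opMatrix A i j = ⟪basisVec i, A (basisVec j)⟫_ℂ := rfl

/-! ### Isometric Schur multipliers are of rank one -/

/-- Lets an explicit operator replace the chosen value of `M_C A`. -/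
theorem IsIsometricSchurMultiplier.schattenNorm_eq {p : ℝ≥0∞} {C : Matrix I I ℂ}
    (h : IsIsometricSchurMultiplier p C) {A B : Ell2 I →L[ℂ] Ell2 I} (hA : A ∈ schattenClass I p)
    (hB : opMatrix B = C ⊙ opMatrix A) : schattenNorm p B = schattenNorm p A := by
  obtain ⟨hC, hiso⟩ := h
  rw [← hiso ⟨A, hA⟩, opMatrix_injective (hB.trans (hC.opMatrix_map ⟨A, hA⟩).symm)]

theorem IsIsometricSchurMultiplier.norm_apply {p : ℝ≥0∞} (hp : 1 ≤ p) {C : Matrix I I ℂ}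
    (h : IsIsometricSchurMultiplier p C) (i j : I) : ‖C i j‖ = 1 := by
  classical
  have hB : opMatrix (rankOne ℂ (C i j • basisVec i) (basisVec j)) =
      C ⊙ opMatrix (rankOne ℂ (basisVec i) (basisVec j)) := by
    ext m n
    simp only [Matrix.hadamard_apply, opMatrix_apply, rankOne_apply, inner_smul_right,
      inner_basisVec]
    by_cases hm : m = i <;> by_cases hn : j = n <;> simp [hm, hn]
  have := h.schattenNorm_eq (rankOne_mem_schattenClass hp _ _) hB
  rw [schattenNorm_rankOne hp, schattenNorm_rankOne hp, norm_smul, norm_basisVec, norm_basisVec,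
    ENNReal.ofReal_eq_ofReal_iff (by positivity) (by norm_num)] at this
  simpa using this

theorem norm_sq_smul_add_smul {i k : I} (hik : i ≠ k) {a c : ℂ} (ha : ‖a‖ = 1) (hc : ‖c‖ = 1) :
    ‖a • basisVec i + c • (basisVec k : Ell2 I)‖ ^ 2 = 2 := by
  classical
  rw [pow_two, norm_add_sq_eq_norm_sq_add_norm_sq_of_inner_eq_zero (𝕜 := ℂ), norm_smul, norm_smul,
    norm_basisVec, norm_basisVec, ha, hc]
  · norm_num
  · simp [inner_smul_left, inner_smul_right, inner_basisVec, hik]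

theorem eq_of_norm_add_eq_two {z w : ℂ} (hz : ‖z‖ = 1) (hw : ‖w‖ = 1) (h : ‖z + w‖ = 2) :
    z = w := by
  have := parallelogram_law_with_norm ℝ z w
  rw [hz, hw, h] at this
  rw [← sub_eq_zero, ← norm_eq_zero]
  nlinarith

theorem IsIsometricSchurMultiplier.mul_eq_mul {p : ℝ≥0∞} (hp : 1 ≤ p) (hp2 : p ≠ 2)
    {C : Matrix I I ℂ} (h : IsIsometricSchurMultiplier p C) (i k j l : I) :
    C i j * C k l = C i l * C k j := by
  classical
  rcases eq_or_ne i k with rfl | hik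
  · ring
  rcases eq_or_ne j l with rfl | hjl
  · ring
  set u : Ell2 I := C i j • basisVec i + C k j • basisVec k with hu
  set v : Ell2 I := C i l • basisVec i + C k l • basisVec k with hv
  have hB : opMatrix (twoColumns j l u v) =
      C ⊙ opMatrix (rankOne ℂ (basisVec i + basisVec k) (basisVec j + basisVec l)) := by
    ext m n
    simp only [Matrix.hadamard_apply, opMatrix_apply, rankOne_apply, inner_smul_right,
      inner_add_right, inner_add_left, inner_basisVec, twoColumns, hu, hv,
      add_apply, smul_add]
    by_cases hm : m = i
    · subst hm
      by_cases hn : j = n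
      · subst hn; simp [hik, hjl.symm]
      · by_cases hn' : l = n
        · subst hn'; simp [hik, hjl]
        · simp [hn, hn']
    · by_cases hm' : m = k
      · subst hm'
        by_cases hn : j = n
        · subst hn; simp [hik.symm, hjl.symm]
        · by_cases hn' : l = n
          · subst hn'; simp [hik.symm, hjl]
          · simp [hn, hn']
      · simp [hm, hm']
  have hsum : ∀ {s t : I}, s ≠ t → ‖(basisVec s + basisVec t : Ell2 I)‖ ^ 2 = 2 := fun hst => by
    simpa using norm_sq_smul_add_smul hst norm_one norm_one
  have hn := h.schattenNorm_eq (rankOne_mem_schattenClass hp _ _) hB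
  have h2 : ‖(basisVec i + basisVec k : Ell2 I)‖ * ‖(basisVec j + basisVec l : Ell2 I)‖ = 2 := by
    rw [← sq_eq_sq₀ (by positivity) (by norm_num), mul_pow, hsum hik, hsum hjl]
    norm_num
  rw [schattenNorm_rankOne hp, h2] at hn
  have hin := norm_inner_of_schattenNorm_twoColumns hp hp2 hjl
    (norm_sq_smul_add_smul hik (h.norm_apply hp _ _) (h.norm_apply hp _ _))
    (norm_sq_smul_add_smul hik (h.norm_apply hp _ _) (h.norm_apply hp _ _)) hn
  have huv : ⟪u, v⟫_ℂ = C i l * star (C i j) + C k l * star (C k j) := by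
    simp [hu, hv, norm_basisVec, inner_basisVec, hik, hik.symm]
  rw [huv] at hin
  have he := eq_of_norm_add_eq_two (by simp [h.norm_apply hp]) (by simp [h.norm_apply hp]) hin
  have hone : ∀ m n, star (C m n) * C m n = 1 := fun m n => by
    rw [Complex.star_def, ← Complex.normSq_eq_conj_mul_self, Complex.normSq_eq_norm_sq,
      h.norm_apply hp]
    norm_num
  -- Multiplying `he` by `C i j * C k j` clears the conjugates, by unimodularity.
  linear_combination (-C i j * C k j) * he + (C i l * C k j) * hone i j -
    (C i j * C k l) * hone k j

/-! ### Diagonal unitaries -/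

section Diagonal

variable {a : I → ℂ}

theorem orthonormal_smul_basisVec (ha : ∀ i, ‖a i‖ = 1) :
    Orthonormal ℂ fun i => a i • (basisVec i : Ell2 I) := by
  classical
  rw [orthonormal_iff_ite]
  intro i j
  rw [inner_smul_left, inner_smul_right, inner_basisVec]
  split_ifs with h
  · subst h
    rw [mul_one, ← Complex.normSq_eq_conj_mul_self, Complex.normSq_eq_norm_sq, ha]
    norm_num
  · simp

theorem top_le_closure_span_smul_basisVec (ha : ∀ i, ‖a i‖ = 1) :
    ⊤ ≤ (Submodule.span ℂ
      (Set.range fun i => a i • (basisVec i : Ell2 I))).topologicalClosure := by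
  rw [← (canonicalBasis I).dense_span]
  apply Submodule.topologicalClosure_mono
  rw [Submodule.span_le]
  rintro _ ⟨i, rfl⟩
  have h0 : a i ≠ 0 := by rw [← norm_ne_zero_iff, ha]; exact one_ne_zero
  have := Submodule.smul_mem _ (a i)⁻¹ (Submodule.subset_span (R := ℂ) (Set.mem_range_self
    (f := fun i => a i • (basisVec i : Ell2 I)) i))
  rwa [smul_smul, inv_mul_cancel₀ h0, one_smul] at this

/-- The unitary operator multiplying the `i`-th coordinate by the unimodular number `a i`. -/
def diagonalUnitary (ha : ∀ i, ‖a i‖ = 1) : unitary (Ell2 I →L[ℂ] Ell2 I) :=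
  Unitary.linearIsometryEquiv.symm <| (canonicalBasis I).repr.trans
    (HilbertBasis.mk (orthonormal_smul_basisVec ha) (top_le_closure_span_smul_basisVec ha)).repr.symm

theorem diagonalUnitary_basisVec (ha : ∀ i, ‖a i‖ = 1) (i : I) :
    (diagonalUnitary ha : Ell2 I →L[ℂ] Ell2 I) (basisVec i) = a i • basisVec i := by
  classical
  rw [diagonalUnitary, Unitary.coe_symm_linearIsometryEquiv_apply]
  change (HilbertBasis.mk (orthonormal_smul_basisVec ha)
    (top_le_closure_span_smul_basisVec ha)).repr.symm
      ((canonicalBasis I).repr (canonicalBasis I i)) = _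
  rw [HilbertBasis.repr_self, HilbertBasis.repr_symm_single, HilbertBasis.coe_mk]

theorem inner_basisVec_diagonalUnitary (ha : ∀ i, ‖a i‖ = 1) (i : I) (x : Ell2 I) :
    ⟪basisVec i, (diagonalUnitary ha : Ell2 I →L[ℂ] Ell2 I) x⟫_ℂ = a i * ⟪basisVec i, x⟫_ℂ := by
  have h := ContinuousLinearMap.inner_map_map_of_mem_unitary (diagonalUnitary ha).2 (basisVec i) x
  rw [diagonalUnitary_basisVec, inner_smul_left] at h
  rw [← h, ← mul_assoc, Complex.mul_conj, Complex.normSq_eq_norm_sq, ha]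
  simp

end Diagonal

/-! ### Invariance of the Schatten norm under diagonal unitaries. -/

section Rotation

variable {a b : I → ℂ}

/-- The operator `U A V`, for the diagonal unitaries `U`, `V` with entries `a`, `b`. -/
def rotate (ha : ∀ i, ‖a i‖ = 1) (hb : ∀ j, ‖b j‖ = 1) (A : Ell2 I →L[ℂ] Ell2 I) :
    Ell2 I →L[ℂ] Ell2 I :=
  diagonalUnitary ha * A * diagonalUnitary hb

theorem opMatrix_rotate (ha : ∀ i, ‖a i‖ = 1) (hb : ∀ j, ‖b j‖ = 1) (A : Ell2 I →L[ℂ] Ell2 I) :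
    opMatrix (rotate ha hb A) = Matrix.of (fun i j => a i * b j) ⊙ opMatrix A := by
  ext i j
  simp only [opMatrix_apply, rotate, mul_apply_eq_comp, inner_basisVec_diagonalUnitary,
    diagonalUnitary_basisVec, map_smul, inner_smul_right, Matrix.hadamard_apply, Matrix.of_apply]
  ring

theorem star_rotate_mul_rotate (ha : ∀ i, ‖a i‖ = 1) (hb : ∀ j, ‖b j‖ = 1)
    (A : Ell2 I →L[ℂ] Ell2 I) :
    star (rotate ha hb A) * rotate ha hb A =
      Unitary.conjStarAlgAut ℂ _ (star (diagonalUnitary hb)) (star A * A) := by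
  have h := Unitary.coe_star_mul_self (diagonalUnitary ha)
  simp only [rotate, star_mul, Unitary.conjStarAlgAut_apply, Unitary.coe_star, star_star, mul_assoc]
  rw [← mul_assoc (star (diagonalUnitary ha : Ell2 I →L[ℂ] Ell2 I)), h, one_mul]

/-- The left unitary cancels in `star A * A`, and the functional calculus commutes with the
conjugation that remains. -/
theorem modulusPow_rotate (ha : ∀ i, ‖a i‖ = 1) (hb : ∀ j, ‖b j‖ = 1) (A : Ell2 I →L[ℂ] Ell2 I)
    {r : ℝ} (hr : 0 ≤ r) : modulusPow (rotate ha hb A) r =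
      Unitary.conjStarAlgAut ℂ _ (star (diagonalUnitary hb)) (modulusPow A r) := by
  rw [modulusPow_eq_cfc, modulusPow_eq_cfc, star_rotate_mul_rotate]
  symm
  have hs : IsSelfAdjoint (star A * A) := .star_mul_self A
  let e := Unitary.conjStarAlgAut ℂ (Ell2 I →L[ℂ] Ell2 I) (star (diagonalUnitary hb))
  let φ : (Ell2 I →L[ℂ] Ell2 I) →⋆ₐ[ℂ] (Ell2 I →L[ℂ] Ell2 I) :=
    { toFun := e, map_one' := map_one e, map_mul' := map_mul e, map_zero' := map_zero e,
      map_add' := map_add e, commutes' := AlgHomClass.commutes e, map_star' := e.map_star' }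
  have hφ : Continuous φ := by
    change Continuous fun x => (star (diagonalUnitary hb) : Ell2 I →L[ℂ] Ell2 I) * x *
      star (star (diagonalUnitary hb) : Ell2 I →L[ℂ] Ell2 I)
    fun_prop
  exact StarAlgHom.map_cfc (R := ℝ) (p := IsSelfAdjoint) (q := IsSelfAdjoint) φ
    (fun x : ℝ => x ^ (r / 2)) _
    (Real.continuous_rpow_const (by positivity)).continuousOn hφ hs (hs.map φ)

theorem schattenNorm_rotate (ha : ∀ i, ‖a i‖ = 1) (hb : ∀ j, ‖b j‖ = 1) (p : ℝ≥0∞)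
    (A : Ell2 I →L[ℂ] Ell2 I) : schattenNorm p (rotate ha hb A) = schattenNorm p A := by
  rw [schattenNorm, schattenNorm]
  split_ifs
  · rw [← ofReal_norm, ← ofReal_norm, rotate, CStarRing.norm_mul_coe_unitary,
      CStarRing.norm_coe_unitary_mul]
  · rw [modulusPow_rotate ha hb A ENNReal.toReal_nonneg]
    congr 1
    -- The remaining unitary is diagonal, so the traces agree term by term: each entry is scaled by
    -- `|b i|² = 1`.
    rw [posTrace, posTrace]
    congr 1
    ext i
    rw [Unitary.conjStarAlgAut_apply, Unitary.coe_star, star_star, mul_apply_eq_comp,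
      mul_apply_eq_comp, ContinuousLinearMap.star_eq_adjoint,
      ContinuousLinearMap.adjoint_inner_right, diagonalUnitary_basisVec, map_smul, inner_smul_left,
      inner_smul_right, ← mul_assoc, ← Complex.normSq_eq_conj_mul_self,
      Complex.normSq_eq_norm_sq, hb]
    simp

theorem rotate_mem_schattenClass (ha : ∀ i, ‖a i‖ = 1) (hb : ∀ j, ‖b j‖ = 1) {p : ℝ≥0∞}
    {A : Ell2 I →L[ℂ] Ell2 I} (hA : A ∈ schattenClass I p) :
    rotate ha hb A ∈ schattenClass I p :=
  ⟨(hA.1.clm_comp (diagonalUnitary ha : Ell2 I →L[ℂ] Ell2 I)).comp_clm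
    (diagonalUnitary hb : Ell2 I →L[ℂ] Ell2 I), by rw [schattenNorm_rotate]; exact hA.2⟩

theorem isIsometricSchurMultiplier_of_mul (ha : ∀ i, ‖a i‖ = 1) (hb : ∀ j, ‖b j‖ = 1)
    (p : ℝ≥0∞) : IsIsometricSchurMultiplier p (Matrix.of fun i j => a i * b j) := by
  have h : IsSchurMultiplier p (Matrix.of fun i j => a i * b j) := fun A hA =>
    ⟨rotate ha hb A, rotate_mem_schattenClass ha hb hA, opMatrix_rotate ha hb A⟩
  refine ⟨h, fun A => ?_⟩
  rw [opMatrix_injective ((h.opMatrix_map A).trans (opMatrix_rotate ha hb A.1).symm),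
    schattenNorm_rotate]

end Rotation

end SchurMult

end

theorem mainTheorem3 {I : Type*} (p : ℝ≥0∞) (hp : 1 ≤ p) (hp2 : p ≠ 2) (C : Matrix I I ℂ) :
    SchurMult.IsIsometricSchurMultiplier p C ↔
      ∃ a b : I → ℂ, (∀ i, ‖a i‖ = 1) ∧ (∀ j, ‖b j‖ = 1) ∧ ∀ i j, C i j = a i * b j := by
  constructor
  · intro h
    rcases isEmpty_or_nonempty I with _ | ⟨⟨o⟩⟩
    · exact ⟨fun _ => 1, fun _ => 1, by simp, by simp, fun i => isEmptyElim i⟩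
    · have h1 := h.norm_apply hp
      -- A rank-one matrix is recovered from the column and row through a reference index `o`.
      refine ⟨fun i => C i o, fun j => C o j / C o o, fun i => h1 i o, fun j => ?_, fun i j => ?_⟩
      · rw [norm_div, h1, h1, div_one]
      · have h0 : C o o ≠ 0 := by rw [← norm_ne_zero_iff, h1]; exact one_ne_zero
        rw [← mul_div_assoc, eq_div_iff h0, h.mul_eq_mul hp hp2 i o j o]
  · rintro ⟨a, b, ha, hb, hC⟩
    rw [show C = Matrix.of fun i j => a i * b j from Matrix.ext hC]
    exact SchurMult.isIsometricSchurMultiplier_of_mul ha hb p
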